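/- Let $G$ be a finite abstract simplicial complex, that is, a finite set of non-empty finite sets such that every non-empty subset of an element of $G$ is again an element of $G$ (the elements of $G$ are called faces). The connection graph $G'$ has the faces of $G$ as vertices, two different faces being adjacent if they intersect; let $A$ be its adjacency matrix and $L = 1 + A$ the connection Laplacian. The Barycentric refinement $G_1$ is the graph which has the faces of $G$ as vertices, two different faces being adjacent if one is a subset of the other. For a vertex $x$ of $G_1$, the unit sphere $S(x)$ is the subgraph of $G_1$ induced on the neighbours of $x$. The Euler characteristic of a finite graph $\Gamma$ is $\chi(\Gamma) = \sum_{s} (-1)^{|s|-1}$, where $s$ runs over the non-empty cliques of $\Gamma$ (vertex sets of complete subgraphs). Then $L$ is invertible over $\mathbb{R}$ and $$\operatorname{tr}(L - L^{-1}) = \eta_1(G) = \sum_{x \in V(G_1)} \chi(S(x)),$$ where $\eta_1(G) = \eta_0(G_1)$ and $\eta_0(\Gamma) = \sum_{x \in V(\Gamma)} \chi(S(x))$ for a finite graph $\Gamma$, with $S(x)$ the subgraph of $\Gamma$ induced on the neighbours of $x$. -/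

import Mathlib

/-- The Euler characteristic `χ(G) = ∑_{x ∈ G} (-1)^{dim x}` of a finite abstract simplicial
complex, where `dim x = |x| - 1` (the faces are non-empty, so the subtraction is a true one).
The complex is a `PreAbstractSimplicialComplex`: a set of non-empty finite sets closed under
taking non-empty subsets. -/
noncomputable def PreAbstractSimplicialComplex.eulerChar {V : Type*}
    (G : PreAbstractSimplicialComplex V) : ℤ :=
  ∑ᶠ x ∈ G.faces, (-1 : ℤ) ^ (x.card - 1)

/-- The Barycentric refinement `G₁`: the graph on the faces of `G` in which two different faces
are adjacent if one is a subset of the other. -/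
def PreAbstractSimplicialComplex.barycentricRefinement {V : Type*}
    (G : PreAbstractSimplicialComplex V) : SimpleGraph G.faces where
  Adj x y := x ≠ y ∧ (x.1 ⊆ y.1 ∨ y.1 ⊆ x.1)
  symm := ⟨fun _ _ h => ⟨h.1.symm, h.2.symm⟩⟩
  loopless := ⟨fun _ h => h.1 rfl⟩

/-- The connection graph `G'`: the graph on the faces of `G` in which two different faces are
adjacent if they intersect. -/
def PreAbstractSimplicialComplex.connectionGraph {V : Type*} [DecidableEq V]
    (G : PreAbstractSimplicialComplex V) : SimpleGraph G.faces where
  Adj x y := x ≠ y ∧ (x.1 ∩ y.1).Nonempty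
  symm := ⟨fun x y h => ⟨h.1.symm, by rw [Finset.inter_comm]; exact h.2⟩⟩
  loopless := ⟨fun _ h => h.1 rfl⟩

instance PreAbstractSimplicialComplex.decidableRelConnectionGraph {V : Type*} [DecidableEq V]
    (G : PreAbstractSimplicialComplex V) :
    DecidableRel G.connectionGraph.Adj :=
  fun x y => inferInstanceAs (Decidable (x ≠ y ∧ (x.1 ∩ y.1).Nonempty))

/-- The connection Laplacian `L = 1 + A`, with `A` the adjacency matrix of the connection
graph. -/
def PreAbstractSimplicialComplex.connectionLaplacian {V : Type*} [DecidableEq V]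
    (G : PreAbstractSimplicialComplex V) : Matrix G.faces G.faces ℝ :=
  1 + G.connectionGraph.adjMatrix ℝ

/-- The Whitney complex of a graph: the vertex sets of its (non-empty) complete subgraphs. -/
def SimpleGraph.whitneyComplex {W : Type*} (Γ : SimpleGraph W) :
    PreAbstractSimplicialComplex W where
  faces := {s | s.Nonempty ∧ Γ.IsClique (s : Set W)}
  isRelLowerSet_faces := fun _ hs =>
    ⟨hs.1, fun _ hts ht => ⟨ht, hs.2.subset (Finset.coe_subset.2 hts)⟩⟩

/-- The unit sphere `S(x)`: the subgraph induced on the vertices adjacent to `x`. -/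
def SimpleGraph.unitSphere {W : Type*} (Γ : SimpleGraph W) (x : W) :
    SimpleGraph (Γ.neighborSet x) :=
  Γ.induce (Γ.neighborSet x)

/-- `η₀(Γ) = ∑_{x ∈ V(Γ)} χ(S(x))`; the Euler characteristic of a graph is that of its Whitney
complex. -/
noncomputable def SimpleGraph.etaZero {W : Type*} [Fintype W] (Γ : SimpleGraph W) : ℤ :=
  ∑ x : W, (Γ.unitSphere x).whitneyComplex.eulerChar

/-- `η₁(G) = η₀(G₁)`. -/
noncomputable def PreAbstractSimplicialComplex.etaOne {V : Type*}
    (G : PreAbstractSimplicialComplex V) [Fintype G.faces] : ℤ :=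
  G.barycentricRefinement.etaZero

/-! Let `C` be the inclusion matrix of the faces and `D` the diagonal matrix of the signs `(-1) ^
dim`. A non-empty simplex has Euler characteristic 1, so `L = Cᵀ D C`; Möbius inversion gives `C⁻¹ =
D C D`, hence `L⁻¹ = D C D Cᵀ D`. Its diagonal entry at `x` is the sum of `(-1) ^ dim z` over the
faces `z ⊇ x`, and `L x x = 1`. It remains to see that this sum is `1 - χ(S(x))`
(`one_sub_eulerChar_unitSphere`). The sphere `S(x)` is the order complex of the proper faces of `x`
placed below the faces strictly containing `x`, and `1 - χ` is multiplicative over such joins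
(`chainSum_union`). Both factors reduce to open Boolean intervals (`chainSum_Ioo`). -/

open Finset in
open scoped Classical in
/-- The sum of `(-1) ^ |c|` over all chains `c ⊆ A`, the empty chain included: one minus the Euler
characteristic of the order complex of `A`. -/
noncomputable def chainSum {α : Type*} [PartialOrder α] (A : Finset α) : ℤ :=
  ∑ c ∈ A.powerset.filter (fun c : Finset α => IsChain (· ≤ ·) (c : Set α)), (-1 : ℤ) ^ #c

/-! ### Signed chain counts in a poset. -/

section ChainSum

open Finset

open scoped Classical

variable {α : Type*} [PartialOrder α]

theorem sum_chains_greatest [DecidableLT α] (A : Finset α) {z : α} (hz : z ∈ A) :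
    ∑ c ∈ A.powerset.filter (fun c : Finset α =>
        IsChain (· ≤ ·) (c : Set α) ∧ IsGreatest (c : Set α) z),
      (-1 : ℤ) ^ #c = -chainSum {w ∈ A | w < z} := by
  rw [chainSum, ← sum_neg_distrib]
  refine sum_bij' (fun c _ => c.erase z) (fun c _ => insert z c) ?_ ?_ ?_ ?_ ?_
  · intro c hc
    simp only [mem_filter, mem_powerset] at hc ⊢
    obtain ⟨hcA, hch, hzc, hub⟩ := hc
    refine ⟨fun w hw => ?_, hch.mono (by simp)⟩
    rw [mem_erase] at hw
    exact mem_filter.2 ⟨hcA hw.2, lt_of_le_of_ne (hub hw.2) hw.1⟩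
  · intro c hc
    simp only [mem_filter, mem_powerset] at hc ⊢
    obtain ⟨hcA, hch⟩ := hc
    have hlt : ∀ w ∈ c, w < z := fun w hw => (mem_filter.1 (hcA hw)).2
    refine ⟨insert_subset hz (hcA.trans (filter_subset _ _)), ?_, by simp, ?_⟩
    · rw [coe_insert]
      exact hch.insert fun w hw _ => Or.inr (hlt w hw).le
    · rw [coe_insert]
      rintro w (rfl | hw)
      · exact le_rfl
      · exact (hlt w hw).le
  · intro c hc
    simp only [mem_filter] at hc
    exact insert_erase (mem_coe.1 hc.2.2.1)
  · intro c hc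
    simp only [mem_filter, mem_powerset] at hc
    exact erase_insert fun h => lt_irrefl _ (mem_filter.1 (hc.1 h)).2
  · intro c hc
    simp only [mem_filter] at hc
    have hzc : z ∈ c := hc.2.2.1
    rw [← card_erase_add_one hzc, pow_succ]
    ring

/-- The empty chain gives the 1; the other chains are sorted by their greatest element, whose
removal flips the sign. -/
theorem chainSum_eq_one_sub_sum [DecidableLT α] (A : Finset α) :
    chainSum A = 1 - ∑ z ∈ A, chainSum {w ∈ A | w < z} := by
  have h : ∀ c ∈ A.powerset.filter (fun c : Finset α => IsChain (· ≤ ·) (c : Set α)),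
      (-1 : ℤ) ^ #c = (if c = ∅ then 1 else 0) +
        ∑ z ∈ A, if IsGreatest (c : Set α) z then (-1 : ℤ) ^ #c else 0 := by
    intro c hc
    simp only [mem_filter, mem_powerset] at hc
    obtain rfl | hne := c.eq_empty_or_nonempty
    · simp [IsGreatest]
    · obtain ⟨m, hm, hmax⟩ := c.exists_maximal hne
      have hg : IsGreatest (c : Set α) m := by
        refine ⟨hm, fun w hw => ?_⟩
        rcases hc.2.total hw hm with h | h
        · exact h
        · exact hmax hw h
      rw [if_neg hne.ne_empty, zero_add, sum_eq_single_of_mem m (hc.1 hm), if_pos hg]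
      intro b _ hb
      exact if_neg fun hb' => hb (hb'.unique hg)
  rw [chainSum, sum_congr rfl h, sum_add_distrib, sum_comm, sub_eq_add_neg, ← sum_neg_distrib]
  congr 1
  · simp
  · refine sum_congr rfl fun z hz => ?_
    rw [← sum_chains_greatest A hz, ← sum_filter, filter_filter]

/-- Every chain of `A` followed by a chain of `B` is again a chain, so chains of the union are pairs
of chains. -/
theorem chainSum_union [DecidableEq α] {A B : Finset α} (h : ∀ a ∈ A, ∀ b ∈ B, a < b) :
    chainSum (A ∪ B) = chainSum A * chainSum B := by
  have hdisj : Disjoint A B := disjoint_left.2 fun a ha hb => lt_irrefl _ (h a ha a hb)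
  rw [chainSum, chainSum, chainSum, sum_mul_sum, ← sum_product']
  symm
  refine sum_bij' (fun p _ => p.1 ∪ p.2) (fun c _ => (c ∩ A, c ∩ B)) ?_ ?_ ?_ ?_ ?_
  · rintro ⟨c, d⟩ hp
    simp only [mem_product, mem_filter, mem_powerset] at hp ⊢
    obtain ⟨⟨hcA, hc⟩, hdB, hd⟩ := hp
    refine ⟨union_subset_union hcA hdB, ?_⟩
    rw [coe_union]
    rintro a (ha | ha) b (hb | hb) hab
    · exact hc ha hb hab
    · exact Or.inl (h a (hcA ha) b (hdB hb)).le
    · exact Or.inr (h b (hcA hb) a (hdB ha)).le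
    · exact hd ha hb hab
  · intro c hc
    simp only [mem_product, mem_filter, mem_powerset] at hc ⊢
    exact ⟨⟨inter_subset_right, hc.2.mono (by simp)⟩, inter_subset_right, hc.2.mono (by simp)⟩
  · rintro ⟨c, d⟩ hp
    simp only [mem_product, mem_filter, mem_powerset] at hp
    obtain ⟨⟨hcA, -⟩, hdB, -⟩ := hp
    have h1 : d ∩ A = ∅ := disjoint_iff_inter_eq_empty.1 (hdisj.symm.mono_left hdB)
    have h2 : c ∩ B = ∅ := disjoint_iff_inter_eq_empty.1 (hdisj.mono_left hcA)
    simp [union_inter_distrib_right, h1, h2, inter_eq_left.2 hcA, inter_eq_left.2 hdB]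
  · intro c hc
    simp only [mem_filter, mem_powerset] at hc
    rw [← inter_union_distrib_left, inter_eq_left.2 hc.1]
  · rintro ⟨c, d⟩ hp
    simp only [mem_product, mem_filter, mem_powerset] at hp
    rw [card_union_of_disjoint (hdisj.mono hp.1.1 hp.2.1), pow_add]

end ChainSum

/-! ### Intervals in the Boolean lattice. -/

section Boolean

open Finset

variable {V : Type*} [DecidableEq V]

theorem sum_Icc_neg_one_pow_card {x z : Finset V} (h : x ⊂ z) :
    ∑ w ∈ Icc x z, (-1 : ℤ) ^ #w = 0 := by
  rw [Icc_eq_image_powerset h.1, sum_image]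
  · have : ∀ w ∈ (z \ x).powerset, (-1 : ℤ) ^ #(x ∪ w) = (-1) ^ #x * (-1) ^ #w := by
      intro w hw
      rw [card_union_of_disjoint, pow_add]
      exact disjoint_sdiff.mono_right (mem_powerset.1 hw)
    rw [sum_congr rfl this, ← mul_sum,
      sum_powerset_neg_one_pow_card_of_nonempty (sdiff_nonempty.2 h.2), mul_zero]
  · intro a ha b hb hab
    have ha' := disjoint_sdiff.mono_right (mem_powerset.1 ha)
    have hb' := disjoint_sdiff.mono_right (mem_powerset.1 hb)
    simpa [union_sdiff_cancel_left ha', union_sdiff_cancel_left hb'] using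
      congrArg (· \ x) hab

theorem sum_Ioo_neg_one_pow_card {x z : Finset V} (h : x ⊂ z) :
    ∑ w ∈ Ioo x z, (-1 : ℤ) ^ #w = -((-1) ^ #x + (-1) ^ #z) := by
  have h1 := sum_Icc_neg_one_pow_card h
  rw [← Ioc_insert_left h.1, sum_insert left_notMem_Ioc,
    ← Ioo_insert_right h, sum_insert right_notMem_Ioo] at h1
  linarith

/-- By Philip Hall's theorem this is minus the Möbius function of the interval. The recursion on the
greatest element leads back to shorter intervals with the same lower end. -/
theorem chainSum_Ioo {x z : Finset V} (h : x ⊂ z) :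
    chainSum (Ioo x z) = (-1) ^ (#x + #z + 1) := by
  induction z using Finset.strongInduction with
  | H z ih =>
    rw [chainSum_eq_one_sub_sum]
    have key : ∀ w ∈ Ioo x z, chainSum {v ∈ Ioo x z | v < w} = (-1) ^ (#x + 1) * (-1) ^ #w := by
      intro w hw
      rw [mem_Ioo] at hw
      have : {v ∈ Ioo x z | v < w} = Ioo x w := by
        ext v
        simp only [mem_filter, mem_Ioo]
        exact ⟨fun hv => ⟨hv.1.1, hv.2⟩, fun hv => ⟨⟨hv.1, hv.2.trans hw.2⟩, hv.2⟩⟩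
      rw [this, ih w hw.2 hw.1]
      ring
    rw [sum_congr rfl key, ← mul_sum, sum_Ioo_neg_one_pow_card h]
    have hx : ((-1 : ℤ) ^ #x) * (-1) ^ #x = 1 := by rw [← mul_pow]; simp
    simp only [pow_add, pow_one]
    linear_combination -hx

end Boolean

/-! ### Clique complexes of comparability graphs. -/

section Whitney

open Finset

open scoped Classical

/-- Cliques of a comparability graph are chains, and the empty chain accounts for the 1. The
embedding `e` allows the count to take place in an ambient order instead of the vertex type. -/
theorem one_sub_eulerChar_whitneyComplex {W α : Type*} [PartialOrder α] (Γ : SimpleGraph W)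
    (e : W ↪ α) (hadj : ∀ v w, Γ.Adj v w ↔ v ≠ w ∧ (e v ≤ e w ∨ e w ≤ e v))
    (A : Finset α) (hA : (A : Set α) = Set.range e) :
    1 - Γ.whitneyComplex.eulerChar = chainSum A := by
  have : Finite W := by
    have : Finite (Set.range e) := hA ▸ A.finite_toSet
    exact Finite.of_injective_finite_range e.injective
  have := Fintype.ofFinite W
  have hmem : ∀ s : Finset W, s ∈ Γ.whitneyComplex.faces ↔
      s ∈ univ.filter (fun s : Finset W => s.Nonempty ∧ Γ.IsClique (s : Set W)) := by
    intro s
    simp [SimpleGraph.whitneyComplex]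
  have hχ : Γ.whitneyComplex.eulerChar =
      -∑ s ∈ univ.filter (fun s : Finset W => s.Nonempty ∧ Γ.IsClique (s : Set W)), (-1 : ℤ) ^ #s := by
    rw [PreAbstractSimplicialComplex.eulerChar,
      finsum_mem_congr (t := ((univ.filter (fun s : Finset W =>
        s.Nonempty ∧ Γ.IsClique (s : Set W)) : Finset (Finset W)) : Set (Finset W)))
        (Set.ext hmem) (fun _ _ => rfl), finsum_mem_coe_finset, ← sum_neg_distrib]
    refine sum_congr rfl fun s hs => ?_
    have hpos : 0 < #s := card_pos.2 (mem_filter.1 hs).2.1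
    obtain ⟨n, hn⟩ := Nat.exists_eq_succ_of_ne_zero hpos.ne'
    simp [hn, pow_succ]
  have hall : ∑ s ∈ univ.filter (fun s : Finset W => Γ.IsClique (s : Set W)), (-1 : ℤ) ^ #s =
      1 + ∑ s ∈ univ.filter (fun s : Finset W => s.Nonempty ∧ Γ.IsClique (s : Set W)), (-1 : ℤ) ^ #s := by
    have : univ.filter (fun s : Finset W => Γ.IsClique (s : Set W)) =
        insert ∅ (univ.filter (fun s : Finset W => s.Nonempty ∧ Γ.IsClique (s : Set W))) := by
      ext s
      obtain rfl | hs := s.eq_empty_or_nonempty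
      · simp
      · simp [hs, hs.ne_empty]
    rw [this, sum_insert (by simp)]
    simp
  rw [hχ, sub_neg_eq_add, ← hall, chainSum]
  have hclique : ∀ s : Finset W,
      Γ.IsClique (s : Set W) ↔ IsChain (· ≤ ·) ((s.map e : Finset α) : Set α) := by
    intro s
    rw [coe_map]
    constructor
    · rintro hs _ ⟨v, hv, rfl⟩ _ ⟨w, hw, rfl⟩ hne
      exact ((hadj v w).1 (hs hv hw fun h => hne (h ▸ rfl))).2
    · intro hs v hv w hw hne
      exact (hadj v w).2 ⟨hne, hs ⟨v, hv, rfl⟩ ⟨w, hw, rfl⟩ (e.injective.ne hne)⟩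
  have hA' : A = univ.map e := by
    rw [← coe_inj, hA]
    simp
  refine sum_bij (fun s _ => s.map e) ?_ (fun _ _ _ _ h => map_injective e h) ?_ ?_
  · intro s hs
    rw [mem_filter] at hs
    rw [mem_filter, mem_powerset, hA']
    exact ⟨map_subset_map.2 (subset_univ s), (hclique s).1 hs.2⟩
  · intro c hc
    rw [mem_filter, mem_powerset, hA', subset_map_iff] at hc
    obtain ⟨⟨u, -, rfl⟩, hc⟩ := hc
    exact ⟨u, mem_filter.2 ⟨mem_univ _, (hclique u).2 hc⟩, rfl⟩
  · intro s _
    rw [card_map]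

end Whitney

/-! ### The connection Laplacian, its inverse, and the unit spheres. -/

namespace PreAbstractSimplicialComplex

open Finset Matrix

variable {V : Type*} (G : PreAbstractSimplicialComplex V)

theorem nonempty_of_mem_faces {s : Finset V} (hs : s ∈ G.faces) : s.Nonempty :=
  (G.isRelLowerSet_faces hs).1

theorem mem_faces_of_subset {s t : Finset V} (hs : s ∈ G.faces) (hts : t ⊆ s)
    (ht : t.Nonempty) : t ∈ G.faces :=
  (G.isRelLowerSet_faces hs).2 hts ht

theorem sum_faces_filter [Fintype G.faces] {M : Type*} [AddCommMonoid M] (T : Finset (Finset V))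
    (p : Finset V → Prop) [DecidablePred p] (hT : ∀ z, z ∈ T ↔ z ∈ G.faces ∧ p z)
    (f : Finset V → M) :
    ∑ z : G.faces, (if p z.1 then f z.1 else 0) = ∑ z ∈ T, f z := by
  rw [← sum_filter]
  refine sum_bij (fun z _ => z.1) ?_ (fun _ _ _ _ h => Subtype.ext h) ?_ (fun _ _ => rfl)
  · intro z hz
    exact (hT _).2 ⟨z.2, (mem_filter.1 hz).2⟩
  · intro z hz
    exact ⟨⟨z, ((hT z).1 hz).1⟩, mem_filter.2 ⟨mem_univ _, ((hT z).1 hz).2⟩, rfl⟩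

variable [DecidableEq V]

/-- The incidence matrix of the face poset: `C z x = 1` if `z ⊆ x`, and `0` otherwise. -/
def inclusionMatrix : Matrix G.faces G.faces ℝ :=
  Matrix.of fun z x => if z.1 ⊆ x.1 then 1 else 0

/-- The diagonal matrix of the signs `(-1) ^ dim x`. -/
def signMatrix : Matrix G.faces G.faces ℝ :=
  Matrix.diagonal fun x => -(-1) ^ #x.1

theorem connectionLaplacian_apply (x y : G.faces) :
    G.connectionLaplacian x y = if (x.1 ∩ y.1).Nonempty then 1 else 0 := by
  rw [connectionLaplacian, Matrix.add_apply, SimpleGraph.adjMatrix_apply, Matrix.one_apply]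
  by_cases h : x = y
  · subst h
    simp [connectionGraph, G.nonempty_of_mem_faces x.2]
  · simp [connectionGraph, h]

variable [Fintype G.faces]

theorem signMatrix_mul_self : G.signMatrix * G.signMatrix = 1 := by
  rw [signMatrix, diagonal_mul_diagonal, ← diagonal_one]
  congr 1
  funext x
  rw [neg_mul_neg, ← mul_pow]
  simp

theorem connectionLaplacian_eq_mul :
    G.connectionLaplacian = G.inclusionMatrixᵀ * G.signMatrix * G.inclusionMatrix := by
  ext x y
  rw [connectionLaplacian_apply, mul_apply]
  have h1 : ∀ z : G.faces, (G.inclusionMatrixᵀ * G.signMatrix) x z * G.inclusionMatrix z y =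
      if z.1 ⊆ x.1 ∩ y.1 then -(-1 : ℝ) ^ #z.1 else 0 := by
    intro z
    rw [signMatrix, mul_diagonal]
    simp only [inclusionMatrix, transpose_apply, of_apply, subset_inter_iff]
    by_cases hx : z.1 ⊆ x.1 <;> by_cases hy : z.1 ⊆ y.1 <;> simp [hx, hy]
  rw [sum_congr rfl fun z _ => h1 z,
    G.sum_faces_filter ((x.1 ∩ y.1).powerset.erase ∅) (· ⊆ x.1 ∩ y.1) ?_
      (fun z => -(-1 : ℝ) ^ #z)]
  · rw [sum_neg_distrib]
    -- The alternating sum over all subsets is 0 unless `x ∩ y` is empty; the empty set, not being a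
    -- face, is taken out and leaves the entry of `L`.
    have h2 := add_sum_erase (x.1 ∩ y.1).powerset (fun z => (-1 : ℤ) ^ #z) (empty_mem_powerset _)
    rw [sum_powerset_neg_one_pow_card] at h2
    have h3 := congrArg (Int.cast : ℤ → ℝ) h2
    push_cast at h3
    simp only [nonempty_iff_ne_empty, ite_not]
    rw [card_empty, pow_zero] at h3
    split_ifs at h3 ⊢ <;> linarith
  · intro z
    rw [mem_erase, mem_powerset, ← nonempty_iff_ne_empty]
    exact ⟨fun h => ⟨G.mem_faces_of_subset x.2 (h.2.trans inter_subset_left) h.1, h.2⟩,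
      fun h => ⟨G.nonempty_of_mem_faces h.1, h.2⟩⟩

/-- Möbius inversion: every set between two faces is a face, so the entries are alternating sums
over full Boolean intervals. -/
theorem inclusionMatrix_mul_inverse :
    G.inclusionMatrix * (G.signMatrix * G.inclusionMatrix * G.signMatrix) = 1 := by
  ext x y
  rw [mul_apply]
  have h1 : ∀ z : G.faces, G.inclusionMatrix x z *
      (G.signMatrix * G.inclusionMatrix * G.signMatrix) z y =
      if x.1 ⊆ z.1 ∧ z.1 ⊆ y.1 then (-1 : ℝ) ^ #z.1 * (-1) ^ #y.1 else 0 := by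
    intro z
    rw [signMatrix, mul_diagonal, diagonal_mul]
    simp only [inclusionMatrix, of_apply]
    by_cases hx : x.1 ⊆ z.1 <;> by_cases hy : z.1 ⊆ y.1 <;> simp [hx, hy]
  rw [sum_congr rfl fun z _ => h1 z,
    G.sum_faces_filter (Icc x.1 y.1) (fun z => x.1 ⊆ z ∧ z ⊆ y.1) ?_
      (fun z => (-1 : ℝ) ^ #z * (-1) ^ #y.1)]
  · rw [← sum_mul, one_apply]
    by_cases hxy : x = y
    · subst hxy
      rw [Icc_self, sum_singleton, ← mul_pow]
      simp
    · rw [if_neg hxy]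
      by_cases hs : x.1 ⊆ y.1
      · have h2 := sum_Icc_neg_one_pow_card
          (hs.ssubset_of_ne fun h => hxy (Subtype.ext h))
        have h3 := congrArg (Int.cast : ℤ → ℝ) h2
        push_cast at h3
        rw [h3, zero_mul]
      · rw [Icc_eq_empty (by simpa using hs)]
        simp
  · intro z
    rw [mem_Icc]
    exact ⟨fun h => ⟨G.mem_faces_of_subset y.2 h.2
      ((G.nonempty_of_mem_faces x.2).mono h.1), h⟩, fun h => h.2⟩

/-- The Green function `D C D Cᵀ D` is a right inverse of the connection Laplacian. -/
theorem connectionLaplacian_mul_inverse :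
    G.connectionLaplacian *
      (G.signMatrix * G.inclusionMatrix * G.signMatrix * G.inclusionMatrixᵀ * G.signMatrix)
      = 1 := by
  have hC := G.inclusionMatrix_mul_inverse
  have hD := G.signMatrix_mul_self
  have hC' : G.inclusionMatrixᵀ * (G.signMatrix * G.inclusionMatrixᵀ * G.signMatrix) = 1 := by
    have h := congrArg transpose (mul_eq_one_comm.1 hC)
    simpa [transpose_mul, signMatrix, Matrix.mul_assoc] using h
  rw [connectionLaplacian_eq_mul]
  calc _ = G.inclusionMatrixᵀ * G.signMatrix *
        (G.inclusionMatrix * (G.signMatrix * G.inclusionMatrix * G.signMatrix)) *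
        (G.inclusionMatrixᵀ * G.signMatrix) := by simp only [Matrix.mul_assoc]
    _ = 1 := by rw [hC, Matrix.mul_one, ← hC']; simp only [Matrix.mul_assoc]

theorem inv_connectionLaplacian_apply_self (x : G.faces) :
    G.connectionLaplacian⁻¹ x x =
      ∑ z : G.faces, if x.1 ⊆ z.1 then -(-1 : ℝ) ^ #z.1 else 0 := by
  rw [inv_eq_right_inv G.connectionLaplacian_mul_inverse, signMatrix, mul_diagonal, mul_apply,
    sum_mul]
  refine sum_congr rfl fun z _ => ?_
  rw [mul_diagonal, diagonal_mul]
  simp only [inclusionMatrix, transpose_apply, of_apply]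
  -- On the diagonal the two outer factors `D` contribute the same sign and cancel.
  have hx : (-1 : ℝ) ^ #x.1 * (-1) ^ #x.1 = 1 := by rw [← mul_pow]; simp
  split_ifs
  · linear_combination -(-1 : ℝ) ^ #z.1 * hx
  · simp

/-- The Euler characteristics of the star and of the unit sphere of `x` add up to one. -/
theorem one_sub_eulerChar_unitSphere (x : G.faces) :
    1 - (G.barycentricRefinement.unitSphere x).whitneyComplex.eulerChar =
      ∑ z : G.faces, if x.1 ⊆ z.1 then -(-1 : ℤ) ^ #z.1 else 0 := by
  classical
  have hxne := G.nonempty_of_mem_faces x.2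
  let B : Finset (Finset V) := {z ∈ (univ : Finset G.faces).image Subtype.val | x.1 < z}
  have hB : ∀ z, z ∈ B ↔ z ∈ G.faces ∧ x.1 < z := by
    intro z
    simp [B]
  let e : G.barycentricRefinement.neighborSet x ↪ Finset V :=
    (Function.Embedding.subtype _).trans (Function.Embedding.subtype _)
  -- The neighbours of `x` are its proper non-empty subsets, `Ioo ∅ x.1`, and its proper supersets
  -- in `G`, `B`.
  rw [one_sub_eulerChar_whitneyComplex (G.barycentricRefinement.unitSphere x) e ?_
    (Ioo ∅ x.1 ∪ B) ?_, chainSum_union ?_, chainSum_Ioo hxne.empty_ssubset,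
    chainSum_eq_one_sub_sum]
  · have key : ∀ w ∈ B, chainSum {v ∈ B | v < w} = (-1) ^ (#x.1 + 1) * (-1) ^ #w := by
      intro w hw
      rw [hB] at hw
      have : {v ∈ B | v < w} = Ioo x.1 w := by
        ext v
        rw [mem_filter, mem_Ioo, hB]
        exact ⟨fun h => ⟨h.1.2, h.2⟩, fun h => ⟨⟨G.mem_faces_of_subset hw.1 h.2.1
          (hxne.mono h.1.1), h.1⟩, h.2⟩⟩
      rw [this, chainSum_Ioo hw.2]
      ring
    -- The product of the two factors is a term for `x` itself plus a sum over `B`, which together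
    -- make up the star of `x`.
    rw [sum_congr rfl key, ← mul_sum, G.sum_faces_filter (insert x.1 B) (x.1 ⊆ ·) ?_
      (fun z => -(-1 : ℤ) ^ #z), sum_insert ?_, sum_neg_distrib]
    · have hx : ((-1 : ℤ) ^ #x.1) * (-1) ^ #x.1 = 1 := by rw [← mul_pow]; simp
      simp only [pow_add, pow_one, card_empty, pow_zero]
      linear_combination (-∑ i ∈ B, (-1 : ℤ) ^ #i) * hx
    · rw [hB]
      exact fun h => lt_irrefl _ h.2
    · intro z
      rw [mem_insert, hB]
      constructor
      · rintro (rfl | h)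
        · exact ⟨x.2, subset_rfl⟩
        · exact ⟨h.1, h.2.1⟩
      · rintro ⟨h1, h2⟩
        by_cases h : z = x.1
        · exact Or.inl h
        · exact Or.inr ⟨h1, h2.ssubset_of_ne (Ne.symm h)⟩
  · intro a ha b hb
    exact (mem_Ioo.1 ha).2.trans ((hB b).1 hb).2
  · intro v w
    exact and_congr (Subtype.val_injective.ne_iff (x := v) (y := w)) Iff.rfl
  · ext z
    rw [mem_coe, mem_union, mem_Ioo, hB, Set.mem_range]
    constructor
    · rintro (⟨h1, h2⟩ | ⟨h1, h2⟩)
      · exact ⟨⟨⟨z, G.mem_faces_of_subset x.2 h2.1 (nonempty_iff_ne_empty.2 h1.ne')⟩,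
          fun h => h2.ne (congrArg Subtype.val h).symm, Or.inr h2.1⟩, rfl⟩
      · exact ⟨⟨⟨z, h1⟩, fun h => h2.ne (congrArg Subtype.val h), Or.inl h2.1⟩, rfl⟩
    · rintro ⟨⟨w, hne, h⟩, rfl⟩
      have hne' : x.1 ≠ w.1 := fun h => hne (Subtype.ext h)
      rcases h with h | h
      · exact Or.inr ⟨w.2, h.ssubset_of_ne hne'⟩
      · exact Or.inl ⟨(G.nonempty_of_mem_faces w.2).empty_ssubset, h.ssubset_of_ne hne'.symm⟩

end PreAbstractSimplicialComplex

theorem mainTheorem1 {V : Type*} [DecidableEq V] (G : PreAbstractSimplicialComplex V)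
    [Fintype G.faces] :
    IsUnit G.connectionLaplacian ∧
      (G.connectionLaplacian - G.connectionLaplacian⁻¹).trace = (G.etaOne : ℝ) ∧
      G.etaOne = ∑ x : G.faces,
        (G.barycentricRefinement.unitSphere x).whitneyComplex.eulerChar := by
  refine ⟨IsUnit.of_mul_eq_one _ G.connectionLaplacian_mul_inverse, ?_, rfl⟩
  rw [PreAbstractSimplicialComplex.etaOne, SimpleGraph.etaZero, Matrix.trace, Int.cast_sum]
  refine Finset.sum_congr rfl fun x _ => ?_
  have h := congrArg (Int.cast : ℤ → ℝ) (G.one_sub_eulerChar_unitSphere x)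
  push_cast at h
  rw [Matrix.diag_apply, Matrix.sub_apply, G.connectionLaplacian_apply,
    G.inv_connectionLaplacian_apply_self, Finset.inter_self,
    if_pos (G.nonempty_of_mem_faces x.2)]
  linarith
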